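/- Let $k$ be an algebraically closed field of characteristic $p\ge 0$, let $X$ be an irreducible smooth proper curve over $k$ (of any genus), with function field $k(X)$, and let $\infty$ be a closed point of $X$. Let $d$ be a positive integer and let $x\in k(X)$ be a function with a pole of order exactly $d$ at $\infty$, regular everywhere else, and such that the extension $k(X)/k(x)$ is separable. Let $D=(D_n)_{n\ge 0}$ be the unique Hasse–Schmidt derivation of $k(X)$ over $k$ extending the standard one on $k(x)$, i.e. such that $D_n(x^m)=\binom{m}{n}x^{m-n}$. Let $0=\delta_1<\delta_2<\cdots$ be the orders of the poles at $\infty$ of the functions on $X$ regular away from $\infty$, and for each $n\ge 1$ let $y_n$ be any function regular away from $\infty$ with a pole of order exactly $\delta_n$ at $\infty$. Let $N\ge 2$, and let $D_N^{\ast}=\dim_k H^0(X,\mathcal O_X(N[\infty]))$, so that $\delta_1,\dots,\delta_{D_N^{\ast}}$ are the $\delta_n$ which are at most $N$. Let $N_0$ be the number of $n\in\{1,\dots,D_N^{\ast}\}$ with $d\mid\delta_n$. Consider the matrix $(D_{j-1}(y_i))$ with rows $1\le i\le D_N^{\ast}$ and columns $j\geq 1$, whose first $N$ columns form the matrix $M_N$.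 For $1\le s_1<\dots<s_{D_N^{\ast}}$, let $$\Pi_{N,s}=\det\big(D_{s_j-1}(y_i)\big)_{1\le i,j\le D_N^{\ast}},$$ which is a minor of $M_N$ if $s_{D_N^{\ast}}\le N$, and let $\Delta_N=\Pi_{N,(1,2,\dots,D_N^{\ast})}$ be the leftmost minor. For an integer $r$ with $0\le r\le N-D_N^{\ast}$, let $s^{(r)}$ be the sequence with $s^{(r)}_i=i$ for $i\le N_0$ and $s^{(r)}_i=i+N-D_N^{\ast}-r$ for $N_0<i\le D_N^{\ast}$. (a) If $p=0$, then $\Pi_{N,s^{(r)}}\ne 0$ for every integer $r$ with $0\le r\le N-D_N^{\ast}$. (b) If $p=0$, or if $p>N$ and $p\nmid d$, then $\Delta_N\neq 0$. -/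

import Mathlib

open AlgebraicGeometry CategoryTheory

universe u

namespace CurveWronskian

/-! ### Hasse-Schmidt derivations -/

/-- Unique lifting along a complete ideal for formally etale algebras. -/
theorem exists_unique_lift {A K S : Type*} [CommRing A] [CommRing K] [CommRing S] [Algebra A K]
    [Algebra.FormallyEtale A K] (ρ : A →+* S) (π : S →+* K) (hπ : Function.Surjective π)
    [IsAdicComplete (RingHom.ker π) S] (h : π.comp ρ = algebraMap A K) :
    ∃! τ : K →+* S, τ.comp (algebraMap A K) = ρ ∧ π.comp τ = RingHom.id K := by
  let := ρ.toAlgebra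
  let πA : S →ₐ[A] K := { π with commutes' := fun a => congrArg (fun f => f a) h }
  let e := Ideal.quotientKerAlgEquivOfSurjective (f := πA) hπ
  have : IsAdicComplete (RingHom.ker πA) S := ‹IsAdicComplete (RingHom.ker π) S›
  obtain ⟨g, hg⟩ := Algebra.FormallySmooth.exists_mkₐ_comp_eq_of_isAdicComplete
    (I := RingHom.ker πA) (e.symm : K →ₐ[A] _)
  have hg' : ∀ a, π (g a) = a := by
    intro a
    have h1 := congrArg e (congrArg (fun f => f a) hg)
    have h2 : πA (g a) = a := by simpa [e] using h1
    exact h2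
  refine ⟨g, ⟨?_, RingHom.ext hg'⟩, ?_⟩
  · ext a
    exact g.commutes a
  · rintro τ ⟨h1, h2⟩
    let t : K →ₐ[A] S := { τ with commutes' := fun a => congrArg (fun f => f a) h1 }
    have : t = g := by
      apply Algebra.FormallyUnramified.ext_of_iInf (I := RingHom.ker πA)
      · simpa using IsHausdorff.iInf_pow_smul (I := RingHom.ker πA) (M := S) inferInstance
      · intro a
        rw [Ideal.Quotient.eq, RingHom.mem_ker, map_sub, sub_eq_zero]
        exact (congrArg (fun f => f a) h2).trans (hg' a).symm
    ext a
    exact congrArg (fun f => f a) this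

section HasseSchmidt

universe v w

/-- A `k`-linear Hasse-Schmidt derivation `D = (D_n)` on a `k`-algebra `K`. -/
structure HasseSchmidtDerivation (k : Type v) (K : Type w) [Field k] [Field K] [Algebra k K] where
  D : ℕ → K →ₗ[k] K
  D_zero : D 0 = LinearMap.id
  leibniz : ∀ (n : ℕ) (f g : K),
    D n (f * g) = ∑ ij ∈ Finset.HasAntidiagonal.antidiagonal n, D ij.1 f * D ij.2 g

variable {k : Type v} {K : Type w} [Field k] [Field K] [Algebra k K]

/-- `D` restricts to the standard Hasse-Schmidt derivation of `k[x]` (hence of `k(x)`):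
`D_n (P(x))` is the value at `x` of the `n`-th Hasse derivative of the polynomial `P`; for
`P = T ^ m` this reads `D_n (x ^ m) = (m choose n) x ^ (m - n)`. -/
def HasseSchmidtDerivation.IsStandard (D : HasseSchmidtDerivation k K) (x : K) : Prop :=
  ∀ (n : ℕ) (P : Polynomial k),
    D.D n (Polynomial.aeval x P) = Polynomial.aeval x (Polynomial.hasseDeriv n P)

theorem HasseSchmidtDerivation.D_one (D : HasseSchmidtDerivation k K) (n : ℕ) (hn : n ≠ 0) :
    D.D n 1 = 0 := by
  induction n using Nat.strong_induction_on with
  | _ n ih =>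
    have h := D.leibniz n 1 1
    rw [mul_one] at h
    obtain ⟨m, rfl⟩ := Nat.exists_eq_succ_of_ne_zero hn
    rw [Finset.Nat.sum_antidiagonal_succ, Finset.Nat.sum_antidiagonal_eq_sum_range_succ_mk,
      Finset.sum_range_succ, Finset.sum_eq_zero] at h
    · simpa [D.D_zero] using h
    · intro i hi
      rw [ih (i + 1) (by simp at hi; omega) (by omega)]
      simp

/-- The Taylor homomorphism `f ↦ ∑ D_n(f) T ^ n` of a Hasse-Schmidt derivation. -/
noncomputable def HasseSchmidtDerivation.taylor (D : HasseSchmidtDerivation k K) :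
    K →+* PowerSeries K where
  toFun f := PowerSeries.mk fun n => D.D n f
  map_zero' := by ext n; simp
  map_add' f g := by ext n; simp
  map_mul' f g := by
    ext n
    simp [PowerSeries.coeff_mul, D.leibniz]
  map_one' := by
    ext n
    rcases eq_or_ne n 0 with rfl | hn
    · simp [D.D_zero]
    · simp [D.D_one n hn, PowerSeries.coeff_one, hn]

open IntermediateField IntermediateField.algebraAdjoinAdjoin in
/-- If `x` is transcendental over `k` and `K / k(x)` is separable (algebraic), then the standard
Hasse-Schmidt derivation of `k(x)` has one and only one extension to `K`. -/
theorem existsUnique_isStandard (x : K) (hx : Transcendental k x)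
    [Algebra.IsSeparable (IntermediateField.adjoin k {x}) K] :
    ∃! D : HasseSchmidtDerivation k K, D.IsStandard x := by
  let A := Algebra.adjoin k {x}
  let e : Polynomial k ≃ₐ[k] A := Polynomial.algEquivOfTranscendental k x hx
  have he : ∀ P, algebraMap A K (e P) = Polynomial.aeval x P := by
    intro P
    simp [e, A, Polynomial.aeval_subalgebra_coe]
  have : Algebra.FormallyEtale A (IntermediateField.adjoin k {x}) :=
    Algebra.FormallyEtale.of_isLocalization (nonZeroDivisors A)
  have : Algebra.FormallyEtale (IntermediateField.adjoin k {x}) K :=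
    Algebra.FormallyEtale.of_isSeparable _ _
  have : Algebra.FormallyEtale A K :=
    Algebra.FormallyEtale.comp A (IntermediateField.adjoin k {x}) K
  let ρ₀ : Polynomial k →+* PowerSeries K :=
    Polynomial.coeToPowerSeries.ringHom.comp
      ((Polynomial.taylorAlgHom x : Polynomial K →ₐ[K] Polynomial K).toRingHom.comp
        (Polynomial.mapRingHom (algebraMap k K)))
  have hρ₀ : ∀ P n, PowerSeries.coeff n (ρ₀ P) =
      Polynomial.aeval x (Polynomial.hasseDeriv n P) := by
    intro P n
    have hm : Polynomial.hasseDeriv n (P.map (algebraMap k K)) =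
        (Polynomial.hasseDeriv n P).map (algebraMap k K) := by
      ext i
      simp [Polynomial.hasseDeriv_coeff]
    simp [ρ₀, Polynomial.taylor_coeff, hm, Polynomial.eval_map_algebraMap]
  let ρ : A →+* PowerSeries K := ρ₀.comp (e.symm : A →+* Polynomial k)
  let π : PowerSeries K →+* K := PowerSeries.constantCoeff
  have hker : RingHom.ker π = Ideal.span {PowerSeries.X} := by
    ext f
    rw [RingHom.mem_ker, Ideal.mem_span_singleton, PowerSeries.X_dvd_iff]
  have : IsAdicComplete (RingHom.ker π) (PowerSeries K) := by
    rw [hker]; infer_instance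
  have hρ : π.comp ρ = algebraMap A K := by
    ext a
    obtain ⟨P, rfl⟩ := e.surjective a
    have := hρ₀ P 0
    rw [he]
    simpa [π, ρ] using this
  obtain ⟨τ, ⟨h1, h2⟩, h3⟩ := exists_unique_lift ρ π (PowerSeries.constantCoeff_surj) hρ
  have h1' : ∀ (P : Polynomial k) (n : ℕ), PowerSeries.coeff n (τ (Polynomial.aeval x P)) =
      Polynomial.aeval x (Polynomial.hasseDeriv n P) := by
    intro P n
    rw [← hρ₀, ← he]
    congr 1
    have := congrArg (fun f : A →+* PowerSeries K => f (e P)) h1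
    simpa [ρ] using this
  have hC : ∀ c : k, τ (algebraMap k K c) = PowerSeries.C (algebraMap k K c) := by
    intro c
    ext n
    have := h1' (Polynomial.C c) n
    rw [Polynomial.aeval_C] at this
    rw [this, PowerSeries.coeff_C]
    split_ifs with hn
    · subst hn; simp
    · rw [Polynomial.hasseDeriv_C n c (Nat.pos_of_ne_zero hn), map_zero]
  refine ⟨{ D := fun n => { toFun := fun f => PowerSeries.coeff n (τ f)
                            map_add' := by simp
                            map_smul' := by
                              intro c f
                              simp [Algebra.smul_def, hC] }
            D_zero := ?_
            leibniz := ?_ }, ?_, ?_⟩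
  · ext f
    have := congrArg (fun φ => φ f) h2
    simpa [π] using this
  · intro n f g
    simp [PowerSeries.coeff_mul]
  · intro n P
    exact h1' P n
  · intro D hD
    have : D.taylor = τ := by
      refine h3 _ ⟨?_, ?_⟩
      · ext a n
        obtain ⟨P, rfl⟩ := e.surjective a
        have := hD n P
        rw [← he] at this
        simpa [HasseSchmidtDerivation.taylor, ρ, hρ₀] using this
      · ext f
        simp [HasseSchmidtDerivation.taylor, π, D.D_zero]
    obtain ⟨D, h0, hl⟩ := D
    congr 1
    ext n f
    have := congrArg (fun φ => PowerSeries.coeff n (φ f)) this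
    simpa [HasseSchmidtDerivation.taylor] using this
open Classical in
/-- `hasseD k x n f` is `D_n(f)`, where `D` is the Hasse-Schmidt derivation of `K` over `k` that
extends the standard one of `k(x)`. By `existsUnique_isStandard`, `D` exists and is unique when `x`
is transcendental over `k` and `K / k(x)` is separable (the value is `0` if there is no such `D`). -/
noncomputable def hasseD (k : Type v) {K : Type w} [Field k] [Field K] [Algebra k K]
    (x : K) (n : ℕ) (f : K) : K :=
  if h : ∃ D : HasseSchmidtDerivation k K, D.IsStandard x then h.choose.D n f else 0

theorem hasseD_eq (x : K) (hx : Transcendental k x)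
    [Algebra.IsSeparable (IntermediateField.adjoin k {x}) K]
    (D : HasseSchmidtDerivation k K) (hD : D.IsStandard x) (n : ℕ) (f : K) :
    hasseD k x n f = D.D n f := by
  have h : ∃ D : HasseSchmidtDerivation k K, D.IsStandard x := ⟨D, hD⟩
  rw [hasseD, dif_pos h, (existsUnique_isStandard x hx).unique h.choose_spec hD]

end HasseSchmidt

/-! ### Functions on a curve -/

section Curve

/-- The function field of an integral `k`-scheme is a `k`-algebra. -/
noncomputable instance functionFieldAlgebra (k : Type u) [Field k] (X : Scheme.{u}) [IsIntegral X]
    [X.Over (Spec (.of k))] : Algebra k X.functionField :=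
  ((X.presheaf.germ ⊤ (genericPoint X) trivial).hom.comp
    ((X ↘ Spec (.of k)).appTop.hom.comp (Scheme.ΓSpecIso (.of k)).inv.hom)).toAlgebra

variable {X : Scheme.{u}} [IsIntegral X]

/-- The rational function `f` is regular at the point `ξ`, that is, `f` lies in the local ring of
`X` at `ξ`. -/
def IsRegularAt (f : X.functionField) (ξ : X) : Prop :=
  f ∈ (algebraMap (X.presheaf.stalk ξ) X.functionField).range

/-- `f` is regular on the complement of the point `P`. -/
def IsRegularAwayFrom (P : X) (f : X.functionField) : Prop :=
  ∀ ξ : X, ξ ≠ P → IsRegularAt f ξ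

/-- `f` has a pole of order exactly `n` at `P`: `f = u / t ^ n` with `t` a uniformizer and `u` a
unit of the local ring at `P` (a discrete valuation ring when `P` is a closed point of a smooth
curve). For `n = 0`, `f` has neither a zero nor a pole at `P`. -/
def HasPoleOfOrder (P : X) (n : ℕ) (f : X.functionField) : Prop :=
  ∃ (t : X.presheaf.stalk P) (u : (X.presheaf.stalk P)ˣ), Irreducible t ∧
    f * algebraMap (X.presheaf.stalk P) X.functionField t ^ n =
      algebraMap (X.presheaf.stalk P) X.functionField u

/-- The set of the orders of the poles at `P` of the functions that are regular away from `P`. -/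
def poleOrders (P : X) : Set ℕ :=
  {n | ∃ f : X.functionField, IsRegularAwayFrom P f ∧ HasPoleOfOrder P n f}

/-- The increasing enumeration of `poleOrders P`, starting from the index `0`. -/
noncomputable def delta (P : X) (n : ℕ) : ℕ :=
  Nat.nth (· ∈ poleOrders P) n

theorem isRegularAt_algebraMap (k : Type u) [Field k] [X.Over (Spec (.of k))] (c : k) (ξ : X) :
    IsRegularAt (algebraMap k X.functionField c) ξ :=
  have : Nonempty (⊤ : X.Opens) := ⟨⟨ξ, trivial⟩⟩
  ⟨X.presheaf.germ ⊤ ξ trivial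
      (((X ↘ Spec (.of k)).appTop.hom.comp (Scheme.ΓSpecIso (.of k)).inv.hom) c),
    Scheme.algebraMap_germ_eq_germToFunctionField X (U := ⊤) (x := ξ) trivial _⟩

/-- The Riemann-Roch space of the divisor `N [P]`: the functions that are regular away from `P` and
have a pole of order at most `N` at `P`. -/
def riemannRochSpace (k : Type u) [Field k] [X.Over (Spec (.of k))] (P : X) (N : ℕ) :
    Submodule k X.functionField where
  carrier := {f | IsRegularAwayFrom P f ∧ ∀ t : X.presheaf.stalk P, Irreducible t →
    IsRegularAt (f * algebraMap (X.presheaf.stalk P) X.functionField t ^ N) P}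
  zero_mem' := ⟨fun ξ _ => zero_mem _, fun t _ => by rw [zero_mul]; exact zero_mem _⟩
  add_mem' := fun hf hg => ⟨fun ξ hξ => add_mem (hf.1 ξ hξ) (hg.1 ξ hξ),
    fun t ht => by rw [add_mul]; exact add_mem (hf.2 t ht) (hg.2 t ht)⟩
  smul_mem' := fun c f hf => ⟨
    fun ξ hξ => by
      rw [Algebra.smul_def]
      exact mul_mem (isRegularAt_algebraMap k c ξ) (hf.1 ξ hξ),
    fun t ht => by
      rw [Algebra.smul_def, mul_assoc]
      exact mul_mem (isRegularAt_algebraMap k c P) (hf.2 t ht)⟩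

/-- `D_N`, the dimension over `k` of the Riemann-Roch space of `N [P]`. -/
noncomputable def dimRR (k : Type u) [Field k] [X.Over (Spec (.of k))] (P : X) (N : ℕ) : ℕ :=
  Module.finrank k (riemannRochSpace k P N)

/-- `N_0`, the number of the indices `n` (among the first `D_N`) with `d ∣ δ_n`. -/
noncomputable def numDivisible (k : Type u) [Field k] [X.Over (Spec (.of k))] (P : X) (d N : ℕ) :
    ℕ :=
  ((Finset.range (dimRR k P N)).filter fun n => d ∣ delta P n).card

/-! ### The wronskian matrix and its minors

Rows and columns are numbered from `0`, so that the entry in column `j` involves `D_j`. -/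

/-- The matrix with the `D_N` rows `(y_i, D_1 y_i, D_2 y_i, …)`. Its first `N` columns form the
matrix `M_N`. -/
noncomputable def wronskianMatrix (k : Type u) [Field k] [X.Over (Spec (.of k))] (P : X)
    (x : X.functionField) (y : ℕ → X.functionField) (N : ℕ) :
    Matrix (Fin (dimRR k P N)) ℕ X.functionField :=
  Matrix.of fun i j => hasseD k x j (y i)

/-- The minor `Π_{N,s}` on the columns `s`. -/
noncomputable def minor (k : Type u) [Field k] [X.Over (Spec (.of k))] (P : X)
    (x : X.functionField) (y : ℕ → X.functionField) (N : ℕ) (s : Fin (dimRR k P N) → ℕ) :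
    X.functionField :=
  ((wronskianMatrix k P x y N).submatrix id s).det

/-- The sequence of columns `s^(r)`: the first `N_0` columns, and then the columns shifted to the
right by `N - D_N - r`. It is meant for `r + D_N ≤ N`; its last term is then less than `N`. -/
noncomputable def columnSeq (k : Type u) [Field k] [X.Over (Spec (.of k))] (P : X) (d N r : ℕ) :
    Fin (dimRR k P N) → ℕ :=
  fun i => if (i : ℕ) < numDivisible k P d N then (i : ℕ) else (i : ℕ) + (N - dimRR k P N - r)

/-- `Δ_N`, the leftmost minor. -/
noncomputable def Delta (k : Type u) [Field k] [X.Over (Spec (.of k))] (P : X)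
    (x : X.functionField) (y : ℕ → X.functionField) (N : ℕ) : X.functionField :=
  minor k P x y N fun i => (i : ℕ)

end Curve

end CurveWronskian

/-!
The minors are controlled by their leading terms at the point `P`. Let `R` be the local ring at `P`
and `θ = x d/dx` the Euler operator on the function field. The `k`-algebra `R` is a discrete
valuation ring with residue field `k` (`isDiscreteValuationRing_stalk`), and its differentials are
generated by `dt`, where `t` is a uniformizer. Since `x` is a unit times `t ^ (-d)`, and `d` is
invertible in `k`, it follows that `θ` maps `R` into the maximal ideal, and that it multiplies a
function with a pole of order `m` by `m / d` to leading order (`exists_euler_eq_mul`).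

The Hasse-Schmidt derivation extending the standard one is iterative, so that `n! D_n` is the `n`-th
iterate of `D_1` (`IsStandard.derivation_iterate`). Hence `x ^ n n! D_n` is the `n`-th falling
factorial of `θ`, and it multiplies a function with a pole of order `m` by the `n`-th falling
factorial of `m / d` to leading order (`exists_pow_mul_iterate_eq_mul`). A minor is therefore
non-zero as soon as the determinant of the falling factorials of the `δ_i / d` is non-zero in `k`
(`minor_ne_zero`).

For the leftmost minor this is the Vandermonde determinant of the `δ_i / d`. In characteristic `p`
these are distinct because `δ_i ≤ N < p`, which rests on the count of the pole orders up to `N`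
(`dimRR_le_count`) and thereby on properness: functions without poles are constant. In
characteristic zero, the integers among the `δ_i / d` are `0, …, N₀ - 1`, because all multiples of
`d` are pole orders. A linear relation between the columns `s^(r)` is a polynomial which, by
triangularity on these integers, involves only the falling factorials of degree at least
`N - D_N - r + N₀`. It then has more roots than its degree allows (`det_descPochhammer_ne_zero`).
-/

namespace CurveWronskian

/-! ### Determinants of falling factorials -/

section Determinants

open Polynomial

variable {k : Type*} [Field k]

theorem eval_natCast_descPochhammer_of_lt {m n : ℕ} (h : m < n) :
    (descPochhammer k n).eval (m : k) = 0 := by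
  rw [descPochhammer_eval_eq_descFactorial, Nat.descFactorial_of_lt h, Nat.cast_zero]

/-- The falling factorials of degrees `s 0 < s 1 < ⋯`, evaluated at `s 0, s 1, …`, form a
triangular matrix with non-zero diagonal. -/
theorem coeff_eq_zero_of_eval_sum_descPochhammer [CharZero k] {n : ℕ} {s : Fin n → ℕ}
    (hs : StrictMono s) (v : Fin n → k) (J : ℕ)
    (h : ∀ j : Fin n, (j : ℕ) < J →
      ∑ i, v i * (descPochhammer k (s i)).eval (s j : k) = 0) :
    ∀ j : Fin n, (j : ℕ) < J → v j = 0 := by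
  intro j
  induction j using WellFoundedLT.induction with
  | _ j ih =>
    intro hj
    have hsum := h j hj
    rw [Finset.sum_eq_single j] at hsum
    · refine (mul_eq_zero.1 hsum).resolve_right ?_
      rw [descPochhammer_eval_eq_descFactorial, Nat.descFactorial_self]
      exact_mod_cast Nat.factorial_ne_zero _
    · intro i _ hij
      rcases lt_or_gt_of_ne hij with hlt | hgt
      · rw [ih i hlt (lt_trans hlt hj), zero_mul]
      · rw [eval_natCast_descPochhammer_of_lt (hs hgt), mul_zero]
    · simp

/-- If the natural numbers among the distinct elements `a i` are exactly `0, …, N₀ - 1`, then the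
falling factorials of degrees `0, …, N₀ - 1, N₀ + e, …, n - 1 + e` are linearly independent as
functions on the `a i`. -/
theorem det_descPochhammer_ne_zero [CharZero k] {n : ℕ} (a : Fin n → k)
    (ha : Function.Injective a) (N₀ e : ℕ) (h₁ : ∀ m < N₀, ∃ i, a i = m)
    (h₂ : ∀ (i : Fin n) (m : ℕ), a i = m → m < N₀) (s : Fin n → ℕ)
    (hs : ∀ i, s i = if (i : ℕ) < N₀ then (i : ℕ) else i + e) :
    (Matrix.of fun i j => (descPochhammer k (s j)).eval (a i)).det ≠ 0 := by
  intro hdet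
  obtain ⟨v, hv, hv0⟩ := Matrix.exists_mulVec_eq_zero_iff.2 hdet
  have hmono : StrictMono s := by
    intro i j hij
    have : (i : ℕ) < j := hij
    rw [hs, hs]
    split_ifs <;> omega
  let Q : k[X] := ∑ j, C (v j) * descPochhammer k (s j)
  have hQ : ∀ b, Q.eval b = ∑ j, v j * (descPochhammer k (s j)).eval b := by
    intro b
    simp [Q, eval_finsetSum]
  have hQa : ∀ i, Q.eval (a i) = 0 := by
    intro i
    simpa [hQ, Matrix.mulVec, dotProduct, mul_comm] using congrFun hv0 i
  have hlow : ∀ j : Fin n, (j : ℕ) < N₀ → v j = 0 := by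
    refine coeff_eq_zero_of_eval_sum_descPochhammer hmono v N₀ fun j hj => ?_
    obtain ⟨i, hi⟩ := h₁ j hj
    rw [hs j, if_pos hj, ← hi, ← hQ, hQa]
  -- `Q` also vanishes at `N₀, …, N₀ + e - 1`, which makes `n + e` roots.
  have hgap : ∀ m, m < N₀ + e → Q.eval (m : k) = 0 := by
    intro m hm
    rw [hQ]
    refine Finset.sum_eq_zero fun j _ => ?_
    rcases lt_or_ge (j : ℕ) N₀ with hj | hj
    · rw [hlow j hj, zero_mul]
    · rw [eval_natCast_descPochhammer_of_lt, mul_zero]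
      rw [hs, if_neg (by omega)]
      omega
  have hQ0 : Q = 0 := by
    rcases Nat.eq_zero_or_pos n with rfl | hn
    · simp [Q]
    classical
    let S : Finset k := Finset.univ.image a ∪ (Finset.Ico N₀ (N₀ + e)).image (fun m : ℕ => (m : k))
    refine eq_zero_of_natDegree_lt_card_of_eval_eq_zero' Q S ?_ ?_
    · intro b hb
      rcases Finset.mem_union.1 hb with hb | hb
      · obtain ⟨i, -, rfl⟩ := Finset.mem_image.1 hb
        exact hQa i
      · obtain ⟨m, hm, rfl⟩ := Finset.mem_image.1 hb
        exact hgap m (Finset.mem_Ico.1 hm).2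
    · have hdisj : Disjoint (Finset.univ.image a)
          ((Finset.Ico N₀ (N₀ + e)).image (fun m : ℕ => (m : k))) := by
        rw [Finset.disjoint_left]
        intro b hb hb'
        obtain ⟨i, -, rfl⟩ := Finset.mem_image.1 hb
        obtain ⟨m, hm, hmi⟩ := Finset.mem_image.1 hb'
        have := h₂ i m hmi.symm
        have := (Finset.mem_Ico.1 hm).1
        omega
      rw [Finset.card_union_of_disjoint hdisj, Finset.card_image_of_injective _ ha,
        Finset.card_image_of_injective _ Nat.cast_injective]
      simp only [Finset.card_univ, Fintype.card_fin, Nat.card_Ico, Nat.add_sub_cancel_left]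
      refine lt_of_le_of_lt (natDegree_sum_le_of_forall_le (n := n - 1 + e) _ _ ?_) (by omega)
      intro j _
      refine (natDegree_C_mul_le _ _).trans ?_
      rw [descPochhammer_natDegree, hs]
      have := j.2
      split_ifs <;> omega
  refine hv (funext fun j => coeff_eq_zero_of_eval_sum_descPochhammer hmono v n ?_ j j.2)
  intro j _
  rw [← hQ, hQ0, eval_zero]

theorem det_descPochhammer_eq_det_vandermonde {n : ℕ} (a : Fin n → k) :
    (Matrix.of fun i j : Fin n => (descPochhammer k j).eval (a i)).det =
      (Matrix.vandermonde a).det :=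
  (Matrix.det_eval_matrixOfPolynomials_eq_det_vandermonde a _
    (fun j => descPochhammer_natDegree k j) fun j => monic_descPochhammer k j).symm

end Determinants

/-! ### Iterates of a Hasse-Schmidt derivation -/

section HasseSchmidt

variable {k K : Type*} [Field k] [Field K] [Algebra k K]

/-- A derivation of `K` is determined by its value at `x` if `K / k(x)` is separable. -/
theorem derivation_eq_zero_of_isSeparable_adjoin (x : K)
    [Algebra.IsSeparable (IntermediateField.adjoin k {x}) K] (E : Derivation k K K)
    (hE : E x = 0) : E = 0 := by
  have hinv : ∀ a, E a = 0 → E a⁻¹ = 0 := by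
    intro a ha
    rw [Derivation.leibniz_inv, ha, smul_zero]
  let L : IntermediateField k K :=
    { carrier := {a | E a = 0}
      mul_mem' := fun {a b} ha hb => by
        simp only [Set.mem_ofPred_eq] at *
        rw [E.leibniz, ha, hb, smul_zero, smul_zero, add_zero]
      add_mem' := fun {a b} ha hb => by
        simp only [Set.mem_ofPred_eq] at *
        rw [map_add, ha, hb, add_zero]
      algebraMap_mem' := fun c => E.map_algebraMap c
      inv_mem' := fun a ha => hinv a ha }
  have hL : IntermediateField.adjoin k {x} ≤ L := by
    rw [IntermediateField.adjoin_le_iff, Set.singleton_subset_iff]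
    exact hE
  let E' : Derivation (IntermediateField.adjoin k {x}) K K :=
    { toFun := E
      map_add' := E.map_add
      map_smul' := fun c a => by
        have hc : E (c : K) = 0 := hL c.2
        rw [IntermediateField.smul_def, smul_eq_mul, E.leibniz, hc, smul_zero, add_zero]
        rfl
      map_one_eq_zero' := E.map_one_eq_zero
      leibniz' := E.leibniz }
  have := Algebra.FormallyUnramified.of_isSeparable (IntermediateField.adjoin k {x}) K
  have hE' : E' = 0 := by
    have : Subsingleton (Ω[K⁄IntermediateField.adjoin k {x}]) := inferInstance
    rw [← Derivation.liftKaehlerDifferential_comp E',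
      Subsingleton.elim (α := Ω[K⁄IntermediateField.adjoin k {x}] →ₗ[K] K)
        E'.liftKaehlerDifferential 0]
    ext
    simp
  ext a
  exact congrArg (fun F : Derivation (IntermediateField.adjoin k {x}) K K => F a) hE'

namespace HasseSchmidtDerivation

variable (D : HasseSchmidtDerivation k K)

/-- The first component of a Hasse-Schmidt derivation is a derivation. -/
noncomputable def derivation : Derivation k K K :=
  Derivation.mk' (D.D 1) fun a b => by
    rw [D.leibniz, Finset.Nat.antidiagonal_succ]
    simp [D.D_zero, mul_comm]

theorem derivation_apply (f : K) : D.derivation f = D.D 1 f := rfl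

variable {D} {x : K}

theorem IsStandard.derivation_self (hD : D.IsStandard x) : D.derivation x = 1 := by
  have := hD 1 Polynomial.X
  rw [derivation_apply]
  simpa using this

/-- The Hasse-Schmidt derivation extending the standard one is iterative: the defect
`D₁ ∘ Dₙ - (n + 1) Dₙ₊₁` is inductively a derivation, and it kills `x`. -/
theorem IsStandard.derivation_apply_D [Algebra.IsSeparable (IntermediateField.adjoin k {x}) K]
    (hD : D.IsStandard x) (n : ℕ) (f : K) :
    D.derivation (D.D n f) = (n + 1 : K) * D.D (n + 1) f := by
  induction n using Nat.strong_induction_on generalizing f with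
  | _ n ih =>
    let e : ℕ → K →ₗ[k] K := fun i =>
      D.derivation.toLinearMap ∘ₗ D.D i - LinearMap.mulLeft k (i + 1 : K) ∘ₗ D.D (i + 1)
    have he : ∀ i f, e i f = D.derivation (D.D i f) - (i + 1 : K) * D.D (i + 1) f :=
      fun i f => rfl
    have he0 : ∀ i < n, ∀ f, e i f = 0 := fun i hi f => by rw [he, ih i hi, sub_self]
    have hsucc : ∀ f g, (n + 1 : K) * D.D (n + 1) (f * g) =
        ∑ ij ∈ Finset.HasAntidiagonal.antidiagonal n, (((ij.1 + 1 : K) * D.D (ij.1 + 1) f) * D.D ij.2 g +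
          D.D ij.1 f * ((ij.2 + 1 : K) * D.D (ij.2 + 1) g)) := by
      intro f g
      have : (n + 1 : K) * D.D (n + 1) (f * g) =
          ∑ ij ∈ Finset.HasAntidiagonal.antidiagonal (n + 1), (ij.1 : K) * (D.D ij.1 f * D.D ij.2 g) +
          ∑ ij ∈ Finset.HasAntidiagonal.antidiagonal (n + 1), (ij.2 : K) * (D.D ij.1 f * D.D ij.2 g) := by
        rw [D.leibniz, Finset.mul_sum, ← Finset.sum_add_distrib]
        refine Finset.sum_congr rfl fun ij hij => ?_
        have hn : (n + 1 : K) = ij.1 + ij.2 := by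
          rw [← Nat.cast_add, Finset.HasAntidiagonal.mem_antidiagonal.1 hij, Nat.cast_succ]
        rw [hn, add_mul]
      rw [this, Finset.Nat.sum_antidiagonal_succ, Finset.Nat.sum_antidiagonal_succ',
        Finset.sum_add_distrib]
      push_cast
      simp only [zero_mul, zero_add]
      congr 1
      · exact Finset.sum_congr rfl fun _ _ => by ring
      · exact Finset.sum_congr rfl fun _ _ => by ring
    have hleib : ∀ f g, e n (f * g) = f • e n g + g • e n f := by
      intro f g
      have h1 : e n (f * g) = ∑ ij ∈ Finset.HasAntidiagonal.antidiagonal n,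
          (e ij.1 f * D.D ij.2 g + D.D ij.1 f * e ij.2 g) := by
        rw [he, hsucc, D.leibniz, map_sum, ← Finset.sum_sub_distrib]
        refine Finset.sum_congr rfl fun ij _ => ?_
        rw [D.derivation.leibniz, he, he, smul_eq_mul, smul_eq_mul]
        ring
      rw [h1, Finset.sum_add_distrib, Finset.sum_eq_single (n, 0), Finset.sum_eq_single (0, n)]
      · simp only [D.D_zero, LinearMap.id_apply, smul_eq_mul]
        ring
      · rintro ⟨i, j⟩ hij hne
        rw [Finset.HasAntidiagonal.mem_antidiagonal] at hij
        simp only [ne_eq, Prod.mk.injEq, not_and] at hij hne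
        rw [he0 j (by by_contra; exact hne (by omega) (by omega)), mul_zero]
      · simp
      · rintro ⟨i, j⟩ hij hne
        rw [Finset.HasAntidiagonal.mem_antidiagonal] at hij
        simp only [ne_eq, Prod.mk.injEq, not_and] at hij hne
        rw [he0 i (by by_contra; exact hne (by omega) (by omega)), zero_mul]
      · simp
    have hX : ∀ m, D.D m x = Polynomial.aeval x (Polynomial.hasseDeriv m (Polynomial.X (R := k))) :=
      fun m => by simpa using hD m Polynomial.X
    have hx : e n x = 0 := by
      rw [he]
      rcases n with _ | _ | n
      · rw [D.D_zero, LinearMap.id_apply, hD.derivation_self, hX]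
        simp
      · rw [hX, hX (0 + 1 + 1), Polynomial.hasseDeriv_X (0 + 1 + 1) (by omega)]
        simp
      · rw [hX, hX (n + 1 + 1 + 1), Polynomial.hasseDeriv_X _ (by omega),
          Polynomial.hasseDeriv_X _ (by omega)]
        simp
    have h0 := derivation_eq_zero_of_isSeparable_adjoin x (Derivation.mk' (e n) hleib) hx
    have h := congrArg (fun F : Derivation k K K => F f) h0
    exact sub_eq_zero.1 h

theorem IsStandard.derivation_iterate [Algebra.IsSeparable (IntermediateField.adjoin k {x}) K]
    (hD : D.IsStandard x) (n : ℕ) (f : K) :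
    D.derivation^[n] f = (n.factorial : K) * D.D n f := by
  induction n with
  | zero => simp [D.D_zero]
  | succ n ih =>
    rw [Function.iterate_succ_apply', ih, D.derivation.leibniz, Derivation.map_natCast,
      hD.derivation_apply_D, Nat.factorial_succ]
    simp only [smul_eq_mul]
    push_cast
    ring

end HasseSchmidtDerivation

end HasseSchmidt

/-! ### Derivations and discrete valuation rings -/

section LocalRing

open IsLocalRing

variable {k R K : Type*} [Field k] [CommRing R] [IsLocalRing R] [Field K]
  [Algebra k R] [Algebra k K] [Algebra R K] [IsScalarTower k R K]

/-- If `R` is essentially of finite type over `k`, with residue field `k`, and its maximal ideal is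
generated by `t`, then `Ω[R⁄k]` is generated by `dt`. -/
theorem span_D_uniformizer_eq_top [Algebra.EssFiniteType k R]
    (hres : ∀ r : R, ∃ c : k, r - algebraMap k R c ∈ maximalIdeal R) (t : R)
    (ht : maximalIdeal R = Ideal.span {t}) :
    Submodule.span R {KaehlerDifferential.D k R t} = ⊤ := by
  rw [eq_top_iff]
  refine Submodule.le_of_le_smul_of_le_jacobson_bot (I := maximalIdeal R) Module.Finite.fg_top
    (maximalIdeal_le_jacobson _) ?_
  rw [← KaehlerDifferential.span_range_derivation k R, Submodule.span_le]
  rintro _ ⟨w, rfl⟩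
  obtain ⟨c, hc⟩ := hres w
  rw [ht, Ideal.mem_span_singleton] at hc
  obtain ⟨w₁, hw⟩ := hc
  rw [sub_eq_iff_eq_add] at hw
  rw [hw, map_add, Derivation.map_algebraMap, add_zero, Derivation.leibniz, add_comm]
  refine Submodule.add_mem_sup (Submodule.smul_mem _ _ (Submodule.mem_span_singleton_self _)) ?_
  refine Submodule.smul_mem_smul (ht ▸ Ideal.mem_span_singleton_self t) ?_
  exact Submodule.subset_span ⟨w₁, rfl⟩

/-- Derivations of `K` are determined on `R` by their value at a uniformizer, and their values on `R`
are `R`-multiples of it. -/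
theorem exists_derivation_eq_mul_uniformizer [Algebra.EssFiniteType k R]
    (hres : ∀ r : R, ∃ c : k, r - algebraMap k R c ∈ maximalIdeal R) (t : R)
    (ht : maximalIdeal R = Ideal.span {t}) (δ : Derivation k K K) (w : R) :
    ∃ s : R, δ (algebraMap R K w) = algebraMap R K s * δ (algebraMap R K t) := by
  have hw : KaehlerDifferential.D k R w ∈ Submodule.span R {KaehlerDifferential.D k R t} := by
    rw [span_D_uniformizer_eq_top hres t ht]
    trivial
  obtain ⟨s, hs⟩ := Submodule.mem_span_singleton.1 hw
  refine ⟨s, ?_⟩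
  have := congrArg (δ.compAlgebraMap R).liftKaehlerDifferential hs
  rw [map_smul, Derivation.liftKaehlerDifferential_comp_D,
    Derivation.liftKaehlerDifferential_comp_D] at this
  rw [← Algebra.smul_def]
  exact this.symm

/-- The Euler operator `x d/dx` on a uniformizer `t`, where `x = u / t ^ d`: it multiplies `t` by
an element of `R` with residue `-1 / d`. -/
theorem exists_euler_uniformizer [Algebra.EssFiniteType k R]
    (hres : ∀ r : R, ∃ c : k, r - algebraMap k R c ∈ maximalIdeal R) (t : R)
    (ht : maximalIdeal R = Ideal.span {t}) (δ : Derivation k K K) {x : K} (hδ : δ x = 1) {d : ℕ}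
    (hd : (d : k) ≠ 0) (u : Rˣ) (hx : x * algebraMap R K t ^ d = algebraMap R K u) :
    ∃ ρ : R, x * δ (algebraMap R K t) = algebraMap R K (t * ρ) ∧ d * ρ + 1 ∈ maximalIdeal R := by
  have htm : t ∈ maximalIdeal R := ht ▸ Ideal.mem_span_singleton_self t
  obtain ⟨s, hs⟩ := exists_derivation_eq_mul_uniformizer hres t ht δ u
  have hdu : IsUnit (d : R) := by
    simpa using (isUnit_iff_ne_zero.2 hd).map (algebraMap k R)
  have hunit : IsUnit (s * t - d * (u : R)) := by
    by_contra h
    have h1 : (d : R) * u ∈ maximalIdeal R := by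
      have := Ideal.sub_mem _ (Ideal.mul_mem_left _ s htm) ((mem_maximalIdeal _).2 h)
      simpa using this
    exact (mem_maximalIdeal _).1 h1 (hdu.mul u.isUnit)
  obtain ⟨q, hq⟩ := hunit.exists_right_inv
  refine ⟨(u : R) * q, ?_, ?_⟩
  · have h1 := congrArg (fun z => x * algebraMap R K t * δ z) hx
    simp only [Derivation.leibniz, Derivation.leibniz_pow, hδ, hs, smul_eq_mul, nsmul_eq_mul,
      mul_one] at h1
    have h2 : algebraMap R K t * ((d : K) * (algebraMap R K t ^ (d - 1) * δ (algebraMap R K t))) =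
        d * (algebraMap R K t ^ d * δ (algebraMap R K t)) := by
      rcases d with _ | d
      · simp
      · rw [Nat.add_sub_cancel, pow_succ]
        ring
    have h3 := congrArg (algebraMap R K) hq
    simp only [map_mul, map_sub, map_natCast, map_one] at h3 ⊢
    linear_combination (-(x * δ (algebraMap R K t))) * h3 + algebraMap R K q * (-h1 + x * x * h2 +
      (algebraMap R K t + d * (x * δ (algebraMap R K t))) * hx)
  · have : d * ((u : R) * q) + 1 = t * (s * q) := by
      linear_combination -hq
    rw [this]
    exact Ideal.mul_mem_right _ _ htm

theorem exists_euler_mem_maximalIdeal [Algebra.EssFiniteType k R]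
    (hres : ∀ r : R, ∃ c : k, r - algebraMap k R c ∈ maximalIdeal R) (t : R)
    (ht : maximalIdeal R = Ideal.span {t}) (δ : Derivation k K K) {x : K} (hδ : δ x = 1) {d : ℕ}
    (hd : (d : k) ≠ 0) (u : Rˣ) (hx : x * algebraMap R K t ^ d = algebraMap R K u) (w : R) :
    ∃ r ∈ maximalIdeal R, x * δ (algebraMap R K w) = algebraMap R K r := by
  obtain ⟨ρ, hρ, -⟩ := exists_euler_uniformizer hres t ht δ hδ hd u hx
  obtain ⟨s, hs⟩ := exists_derivation_eq_mul_uniformizer hres t ht δ w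
  refine ⟨t * (ρ * s), Ideal.mul_mem_right _ _ (ht ▸ Ideal.mem_span_singleton_self t), ?_⟩
  rw [hs, mul_left_comm, hρ]
  simp only [map_mul]
  ring

/-- A function `f` with a pole of order `m` is, to leading order, an eigenvector of the Euler
operator `x d/dx` with eigenvalue `m / d`. -/
theorem exists_euler_eq_mul [Algebra.EssFiniteType k R]
    (hres : ∀ r : R, ∃ c : k, r - algebraMap k R c ∈ maximalIdeal R) (t : R)
    (ht : maximalIdeal R = Ideal.span {t}) (δ : Derivation k K K) {x : K} (hδ : δ x = 1) {d : ℕ}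
    (hd : (d : k) ≠ 0) (u : Rˣ) (hx : x * algebraMap R K t ^ d = algebraMap R K u) {m : ℕ} {f : K}
    (v : Rˣ) (hf : f * algebraMap R K t ^ m = algebraMap R K v) :
    ∃ r ∈ maximalIdeal R,
      x * δ f = f * (algebraMap k K (m / d) + algebraMap R K r) := by
  obtain ⟨ρ, hρ, hρd⟩ := exists_euler_uniformizer hres t ht δ hδ hd u hx
  obtain ⟨r, hr, hrv⟩ := exists_euler_mem_maximalIdeal hres t ht δ hδ hd u hx v
  refine ⟨↑v⁻¹ * r - algebraMap k R (m / d) * (d * ρ + 1),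
    Ideal.sub_mem _ (Ideal.mul_mem_left _ _ hr) (Ideal.mul_mem_left _ _ hρd), ?_⟩
  have h1 := congrArg (fun z => x * δ z) hf
  simp only [Derivation.leibniz, Derivation.leibniz_pow, hrv, smul_eq_mul, nsmul_eq_mul] at h1
  have h2 : x * ((m : K) * (algebraMap R K t ^ (m - 1) * δ (algebraMap R K t))) =
      m * (algebraMap R K t ^ m * algebraMap R K ρ) := by
    rcases m with _ | m
    · simp
    · rw [Nat.add_sub_cancel, pow_succ]
      rw [map_mul] at hρ
      linear_combination ((m + 1 : ℕ) : K) * algebraMap R K t ^ m * hρ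
  have hv : algebraMap R K v * algebraMap R K ↑v⁻¹ = 1 := by
    rw [← map_mul, Units.mul_inv, map_one]
  have hdK : (d : K) ≠ 0 := by
    simpa using (map_ne_zero (algebraMap k K)).2 hd
  have hmd : algebraMap k K (m / d) * d = m := by
    rw [map_div₀, map_natCast, map_natCast, div_mul_cancel₀ _ hdK]
  simp only [map_sub, map_mul, map_add, map_one, map_natCast, ← IsScalarTower.algebraMap_apply k R K]
  linear_combination (-(x * δ f)) * hv + algebraMap R K ↑v⁻¹ * (-(x * δ f) * hf + f * h1 -
    f * f * h2 - f * m * algebraMap R K ρ * hf) - f * m * algebraMap R K ρ * hv +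
    f * algebraMap R K ρ * hmd

/-- The leading term of the `n`-th derivative: on functions with a pole of order `m`,
`xⁿ (d/dx)ⁿ` acts to leading order by the falling factorial of `m / d`, because it is the falling
factorial of the Euler operator. -/
theorem exists_pow_mul_iterate_eq_mul [Algebra.EssFiniteType k R]
    (hres : ∀ r : R, ∃ c : k, r - algebraMap k R c ∈ maximalIdeal R) (t : R)
    (ht : maximalIdeal R = Ideal.span {t}) (δ : Derivation k K K) {x : K} (hδ : δ x = 1) {d : ℕ}
    (hd : (d : k) ≠ 0) (u : Rˣ) (hx : x * algebraMap R K t ^ d = algebraMap R K u) {m : ℕ} {f : K}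
    (v : Rˣ) (hf : f * algebraMap R K t ^ m = algebraMap R K v) (n : ℕ) :
    ∃ r ∈ maximalIdeal R, x ^ n * δ^[n] f =
      f * (algebraMap k K ((descPochhammer k n).eval (m / d : k)) + algebraMap R K r) := by
  induction n with
  | zero => exact ⟨0, zero_mem _, by simp⟩
  | succ n ih =>
    obtain ⟨r, hr, h⟩ := ih
    obtain ⟨r₁, hr₁, h₁⟩ := exists_euler_eq_mul hres t ht δ hδ hd u hx v hf
    obtain ⟨r₂, hr₂, h₂⟩ := exists_euler_mem_maximalIdeal hres t ht δ hδ hd u hx r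
    refine ⟨algebraMap k R ((descPochhammer k n).eval (m / d : k)) * r₁ +
      (algebraMap k R (m / d) + r₁) * r + r₂ - n * r, ?_, ?_⟩
    · exact Ideal.sub_mem _ (Ideal.add_mem _ (Ideal.add_mem _ (Ideal.mul_mem_left _ _ hr₁)
        (Ideal.mul_mem_left _ _ hr)) hr₂) (Ideal.mul_mem_left _ _ hr)
    · have h3 := congrArg (fun z => x * δ z) h
      simp only [Derivation.leibniz, Derivation.leibniz_pow, hδ, smul_eq_mul, nsmul_eq_mul,
        mul_one, map_add, Derivation.map_algebraMap, zero_add] at h3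
      have h4 : x * ((n : K) * x ^ (n - 1)) = n * x ^ n := by
        rcases n with _ | n
        · simp
        · rw [Nat.add_sub_cancel, pow_succ]
          ring
      rw [Function.iterate_succ_apply', descPochhammer_succ_eval]
      simp only [map_sub, map_mul, map_add, map_natCast, ← IsScalarTower.algebraMap_apply k R K]
      linear_combination h3 - δ^[n] f * h4 - n * h + f * h₂ +
        (algebraMap k K ((descPochhammer k n).eval (m / d : k)) + algebraMap R K r) * h₁

/-- A determinant over `K` is non-zero if, after scaling the rows and the columns, its entries lie
in `R` and the determinant of their residues is non-zero. -/
theorem det_ne_zero_of_residue {n : ℕ} (hinj : Function.Injective (algebraMap R K))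
    (A : Matrix (Fin n) (Fin n) K) (y z : Fin n → K) (c : Matrix (Fin n) (Fin n) k)
    (r : Matrix (Fin n) (Fin n) R) (hr : ∀ i j, r i j ∈ maximalIdeal R) (hy : ∀ i, y i ≠ 0)
    (h : ∀ i j, z j * A i j = y i * (algebraMap k K (c i j) + algebraMap R K (r i j)))
    (hc : c.det ≠ 0) : A.det ≠ 0 := by
  intro hA
  let B : Matrix (Fin n) (Fin n) R := c.map (algebraMap k R) + r
  have hB : algebraMap R K B.det = 0 := by
    have h1 : (Matrix.of fun i j => z j * A i j).det =
        (Matrix.of fun i j => y i * (algebraMap R K).mapMatrix B i j).det := by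
      congr 1
      ext i j
      simp [h, B, ← IsScalarTower.algebraMap_apply k R K]
    rw [Matrix.det_mul_row, Matrix.det_mul_column, hA, mul_zero, ← RingHom.map_det] at h1
    exact (mul_eq_zero.1 h1.symm).resolve_left (Finset.prod_ne_zero_iff.2 fun i _ => hy i)
  rw [map_eq_zero_iff _ hinj] at hB
  have h2 := congrArg (residue R) hB
  rw [map_zero, RingHom.map_det] at h2
  have h3 : (residue R).mapMatrix B = ((residue R).comp (algebraMap k R)).mapMatrix c := by
    ext i j
    simp [B, (residue_eq_zero_iff _).2 (hr i j)]
  rw [h3, ← RingHom.map_det, map_eq_zero] at h2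
  exact hc h2

end LocalRing

/-! ### Local rings of smooth curves -/

section SmoothLocalRing

open IsLocalRing TensorProduct

variable {k R : Type*} [Field k] [CommRing R] [Algebra k R]

/-- A smooth local `k`-algebra with residue field `k` and with a cyclic module of differentials
is a discrete valuation ring: by smoothness the cotangent space embeds into the fibre of `Ω[R⁄k]` at
the closed point, so that it is at most one-dimensional. -/
theorem isDiscreteValuationRing_of_formallySmooth [IsLocalRing R] [IsDomain R] [IsNoetherianRing R]
    [Algebra.FormallySmooth k R]
    (hres : ∀ r : R, ∃ c : k, r - algebraMap k R c ∈ maximalIdeal R) (ω : Ω[R⁄k])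
    (hω : Submodule.span R {ω} = ⊤) (hR : ¬ IsField R) : IsDiscreteValuationRing R := by
  let κ := ResidueField R
  have hsurj : Function.Surjective (algebraMap R κ) := residue_surjective
  have hker : RingHom.ker (algebraMap R κ) = maximalIdeal R := ker_residue
  have hbij : Function.Bijective (algebraMap k κ) := by
    refine ⟨(algebraMap k κ).injective, fun a => ?_⟩
    obtain ⟨r, rfl⟩ := hsurj a
    obtain ⟨c, hc⟩ := hres r
    refine ⟨c, ?_⟩
    rw [← hker, RingHom.mem_ker, map_sub, sub_eq_zero] at hc
    rw [hc, ← IsScalarTower.algebraMap_apply]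
  have : Algebra.FormallySmooth k κ :=
    Algebra.FormallySmooth.of_equiv (AlgEquiv.ofBijective (Algebra.ofId k κ) hbij)
  obtain ⟨l, hl⟩ := (Algebra.FormallySmooth.iff_split_injection (R := k) (P := R) hsurj).1 this
  have hinj : Function.Injective (KaehlerDifferential.kerCotangentToTensor k R κ) :=
    Function.LeftInverse.injective (g := l) fun a => congrArg (fun φ => φ a) hl
  have hspan : ∀ z : κ ⊗[R] Ω[R⁄k], ∃ r : R, z = r • (1 ⊗ₜ[R] ω) := by
    intro z
    induction z with
    | zero => exact ⟨0, by simp⟩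
    | add a b ha hb =>
      obtain ⟨r, rfl⟩ := ha
      obtain ⟨s, rfl⟩ := hb
      exact ⟨r + s, by rw [add_smul]⟩
    | tmul a η =>
      obtain ⟨r, rfl⟩ := hsurj a
      obtain ⟨s, rfl⟩ := Submodule.mem_span_singleton.1 (hω ▸ Submodule.mem_top : η ∈ _)
      refine ⟨r * s, ?_⟩
      rw [TensorProduct.tmul_smul, mul_comm, mul_smul, TensorProduct.smul_tmul' r,
        Algebra.smul_def, mul_one]
  refine ((IsDiscreteValuationRing.TFAE R hR).out 0 4).2 ?_
  by_cases hm : maximalIdeal R ≤ maximalIdeal R ^ 2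
  · have h0 : maximalIdeal R ≤ ⊥ := by
      refine Submodule.le_of_le_smul_of_le_jacobson_bot (I := maximalIdeal R)
        (IsNoetherian.noetherian _) (maximalIdeal_le_jacobson _) ?_
      rwa [bot_sup_eq, smul_eq_mul, ← pow_two]
    rw [le_bot_iff] at h0
    exact absurd (isField_iff_maximalIdeal_eq.2 h0) hR
  obtain ⟨a, ha, ha2⟩ := Set.not_subset.1 hm
  let φ : maximalIdeal R → κ ⊗[R] Ω[R⁄k] := fun b => 1 ⊗ₜ[R] KaehlerDifferential.D k R b
  have hφ : ∀ (b : R) (hb : b ∈ maximalIdeal R), φ ⟨b, hb⟩ = 0 → b ∈ maximalIdeal R ^ 2 := by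
    intro b hb h
    have hb' : b ∈ RingHom.ker (algebraMap R κ) := hker ▸ hb
    have h1 := KaehlerDifferential.kerCotangentToTensor_toCotangent k R κ ⟨b, hb'⟩
    rw [show (1 : κ) ⊗ₜ[R] KaehlerDifferential.D k R b = 0 from h] at h1
    have h2 := (map_eq_zero_iff _ hinj).1 h1
    rw [Ideal.toCotangent_eq_zero] at h2
    exact hker ▸ h2
  have hφ_mul : ∀ (c b : R) (hb : b ∈ maximalIdeal R),
      φ ⟨c * b, Ideal.mul_mem_left _ c hb⟩ = c • φ ⟨b, hb⟩ := by
    intro c b hb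
    have hb0 : algebraMap R κ b = 0 := by rwa [← hker] at hb
    simp only [φ, Derivation.leibniz, TensorProduct.tmul_add, TensorProduct.tmul_smul]
    rw [TensorProduct.smul_tmul' b, Algebra.smul_def, hb0, zero_mul, TensorProduct.zero_tmul,
      add_zero]
  obtain ⟨ra, hra⟩ := hspan (φ ⟨a, ha⟩)
  have hraunit : IsUnit ra := by
    by_contra h
    refine ha2 (hφ a ha ?_)
    have h0 : algebraMap R κ ra = 0 := by
      rw [← RingHom.mem_ker, hker]
      exact h
    rw [hra, TensorProduct.smul_tmul', Algebra.smul_def, h0, zero_mul, TensorProduct.zero_tmul]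
  refine ⟨a, le_antisymm ?_ ?_⟩
  · refine Submodule.le_of_le_smul_of_le_jacobson_bot (I := maximalIdeal R)
      (IsNoetherian.noetherian _) (maximalIdeal_le_jacobson _) fun b hb => ?_
    obtain ⟨rb, hrb⟩ := hspan (φ ⟨b, hb⟩)
    obtain ⟨q, hq⟩ := hraunit.exists_left_inv
    have h2 : b - rb * q * a ∈ maximalIdeal R ^ 2 := by
      refine hφ _ (Ideal.sub_mem _ hb (Ideal.mul_mem_left _ (rb * q) ha)) ?_
      have : φ ⟨b - rb * q * a, Ideal.sub_mem _ hb (Ideal.mul_mem_left _ _ ha)⟩ =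
          φ ⟨b, hb⟩ - φ ⟨rb * q * a, Ideal.mul_mem_left _ _ ha⟩ := by
        simp only [φ, map_sub, TensorProduct.tmul_sub]
      rw [this, hφ_mul (rb * q) a ha, hra, hrb, smul_smul, mul_assoc, hq, mul_one, sub_self]
    rw [smul_eq_mul, ← pow_two]
    refine Submodule.mem_sup.2 ⟨rb * q * a, Submodule.smul_mem _ _
      (Submodule.mem_span_singleton_self a), _, h2, by ring⟩
  · exact (Submodule.span_singleton_le_iff_mem _ _).2 ha

/-- The module of differentials of a localization of a standard smooth algebra of relative
dimension one is cyclic. -/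
theorem exists_span_kaehlerDifferential_eq_top {A : Type*} [CommRing A] [Algebra k A] [Algebra A R]
    [IsScalarTower k A R] [Nontrivial A] (M : Submonoid A) [IsLocalization M R]
    [Algebra.IsStandardSmoothOfRelativeDimension 1 k A] :
    ∃ ω : Ω[R⁄k], Submodule.span R {ω} = ⊤ := by
  have : Algebra.IsStandardSmooth k A :=
    Algebra.IsStandardSmoothOfRelativeDimension.isStandardSmooth 1
  have hrank : Module.rank A (Ω[A⁄k]) = 1 := by
    simpa using Algebra.IsStandardSmoothOfRelativeDimension.rank_kaehlerDifferential
      (R := k) (S := A) 1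
  have hfin : Module.finrank A (Ω[A⁄k]) = 1 := by rw [Module.finrank, hrank, Cardinal.one_toNat]
  obtain ⟨ω, hω⟩ : ∃ ω : Ω[A⁄k], ∀ η, ∃ a : A, a • ω = η := by
    let b := Module.basisUnique Unit hfin
    refine ⟨b (), fun η => ⟨b.repr η (), ?_⟩⟩
    conv_rhs => rw [← b.sum_repr η]
    simp
  refine ⟨KaehlerDifferential.map k k A R ω, ?_⟩
  rw [eq_top_iff, ← KaehlerDifferential.span_range_map_derivation_of_isLocalization k A R M,
    Submodule.span_le]
  rintro _ ⟨a, rfl⟩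
  obtain ⟨c, hc⟩ := hω (KaehlerDifferential.D k A a)
  rw [Function.comp_apply, ← hc, map_smul, ← algebraMap_smul R c]
  exact Submodule.smul_mem _ _ (Submodule.mem_span_singleton_self _)

end SmoothLocalRing

section Stalk

open IsLocalRing

variable (k : Type u) [Field k] (X : Scheme.{u}) [X.Over (Spec (.of k))]

/-- The local rings of a `k`-scheme are `k`-algebras. The structure map is the one that
`functionFieldAlgebra` uses at the generic point, so that both are compatible. It is not a global
instance, since the function field is itself a local ring. -/
noncomputable abbrev stalkAlgebra (ξ : X) : Algebra k (X.presheaf.stalk ξ) :=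
  ((X.presheaf.germ ⊤ ξ trivial).hom.comp
    ((X ↘ Spec (.of k)).appTop.hom.comp (Scheme.ΓSpecIso (.of k)).inv.hom)).toAlgebra

attribute [local instance] stalkAlgebra

theorem isScalarTower_stalk_functionField [IsIntegral X] (ξ : X) :
    IsScalarTower k (X.presheaf.stalk ξ) X.functionField := by
  refine IsScalarTower.of_algebraMap_eq fun c => ?_
  have : Nonempty (⊤ : X.Opens) := ⟨⟨ξ, trivial⟩⟩
  exact (Scheme.algebraMap_germ_eq_germToFunctionField X (U := ⊤) (x := ξ) trivial _).symm

/-- Locally at each point, a smooth curve is the spectrum of a standard smooth algebra of relative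
dimension one. -/
theorem exists_isStandardSmooth_isLocalization_stalk
    [SmoothOfRelativeDimension 1 (X ↘ Spec (.of k))] (ξ : X) :
    ∃ (A : Type u) (_ : CommRing A) (_ : Algebra k A) (_ : Algebra A (X.presheaf.stalk ξ))
      (_ : IsScalarTower k A (X.presheaf.stalk ξ)) (M : Submonoid A),
      IsLocalization M (X.presheaf.stalk ξ) ∧
      Algebra.IsStandardSmoothOfRelativeDimension 1 k A := by
  obtain ⟨U, hU, V, hV, hξ, e, hf⟩ :=
    SmoothOfRelativeDimension.exists_isStandardSmoothOfRelativeDimension (n := 1)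
      (f := X ↘ Spec (.of k)) ξ
  obtain rfl : U = ⊤ := by
    refine top_le_iff.1 fun z _ => ?_
    rw [Subsingleton.elim z ((X ↘ Spec (.of k)) ξ)]
    exact e hξ
  refine ⟨Γ(X, V), inferInstance,
    (((X ↘ Spec (.of k)).appLE ⊤ V e).hom.comp (Scheme.ΓSpecIso (.of k)).inv.hom).toAlgebra,
    TopCat.Presheaf.algebra_section_stalk X.presheaf ⟨ξ, hξ⟩, ?_,
    (hV.primeIdealOf ⟨ξ, hξ⟩).asIdeal.primeCompl, hV.isLocalization_stalk ⟨ξ, hξ⟩, ?_⟩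
  · let : Algebra k Γ(X, V) :=
      (((X ↘ Spec (.of k)).appLE ⊤ V e).hom.comp (Scheme.ΓSpecIso (.of k)).inv.hom).toAlgebra
    let : Algebra Γ(X, V) (X.presheaf.stalk ξ) :=
      TopCat.Presheaf.algebra_section_stalk X.presheaf ⟨ξ, hξ⟩
    refine IsScalarTower.of_algebraMap_eq fun c => ?_
    exact (X.presheaf.germ_res_apply (homOfLE e) ξ hξ _).symm
  · exact RingHom.isStandardSmoothOfRelativeDimension_respectsIso.2
      ((X ↘ Spec (.of k)).appLE ⊤ V e).hom
      (Scheme.ΓSpecIso (.of k)).symm.commRingCatIsoToRingEquiv hf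

/-- By the Nullstellensatz, the residue field at a closed point is `k`. -/
theorem exists_sub_algebraMap_mem_maximalIdeal [IsAlgClosed k]
    [LocallyOfFiniteType (X ↘ Spec (.of k))] (P : X) (hP : IsClosed {P})
    (r : X.presheaf.stalk P) :
    ∃ c : k, r - algebraMap k (X.presheaf.stalk P) c ∈ maximalIdeal (X.presheaf.stalk P) := by
  let f := X ↘ Spec (.of k)
  have h : (Scheme.ΓSpecIso (.of k)).inv ≫ f.appTop ≫ X.presheaf.germ ⊤ P trivial ≫
      X.residue P = (residueFieldIsoBase f P hP).inv := by
    have h0 := congrArg Scheme.Hom.appTop (SpecMap_residueFieldIsoBase_inv f P hP)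
    rw [Scheme.fromSpecResidueField, Scheme.Hom.comp_appTop, Scheme.Hom.comp_appTop,
      Scheme.fromSpecStalk_appTop] at h0
    rw [Iso.inv_comp_eq, ← Scheme.ΓSpecIso_naturality, h0]
    simp
  refine ⟨(residueFieldIsoBase f P hP).hom (X.residue P r), ?_⟩
  rw [← ker_residue, RingHom.mem_ker, map_sub, sub_eq_zero]
  have h2 := congrArg (fun φ => φ ((residueFieldIsoBase f P hP).hom (X.residue P r))) h
  refine Eq.trans ?_ h2.symm
  exact ((residueFieldIsoBase f P hP).hom_inv_id_apply (X.residue P r)).symm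

theorem essFiniteType_stalk [SmoothOfRelativeDimension 1 (X ↘ Spec (.of k))] (ξ : X) :
    Algebra.EssFiniteType k (X.presheaf.stalk ξ) := by
  obtain ⟨A, _, _, _, _, M, _, _⟩ := exists_isStandardSmooth_isLocalization_stalk k X ξ
  have : Algebra.IsStandardSmooth k A :=
    Algebra.IsStandardSmoothOfRelativeDimension.isStandardSmooth 1
  have : Algebra.FinitePresentation k A := inferInstance
  have := Algebra.EssFiniteType.of_isLocalization (X.presheaf.stalk ξ) M
  exact Algebra.EssFiniteType.comp k A (X.presheaf.stalk ξ)

/-- The local ring of a smooth curve at a closed point is a discrete valuation ring. An irreducible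
element of it serves to exclude that it is a field. -/
theorem isDiscreteValuationRing_stalk (k : Type u) [Field k] [IsAlgClosed k] {X : Scheme.{u}}
    [IsIntegral X] [X.Over (Spec (.of k))]
    [SmoothOfRelativeDimension 1 (X ↘ Spec (.of k))] {P : X} (hP : IsClosed {P})
    {t : X.presheaf.stalk P} (ht : Irreducible t) :
    IsDiscreteValuationRing (X.presheaf.stalk P) := by
  have : Smooth (X ↘ Spec (.of k)) := SmoothOfRelativeDimension.smooth 1 _
  obtain ⟨A, _, _, _, _, M, _, _⟩ := exists_isStandardSmooth_isLocalization_stalk k X P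
  have : Algebra.IsStandardSmooth k A :=
    Algebra.IsStandardSmoothOfRelativeDimension.isStandardSmooth 1
  have : Nontrivial A := (algebraMap A (X.presheaf.stalk P)).domain_nontrivial
  have : IsNoetherianRing A := Algebra.FiniteType.isNoetherianRing k A
  have : IsNoetherianRing (X.presheaf.stalk P) := IsLocalization.isNoetherianRing M _ ‹_›
  have : Algebra.FormallySmooth A (X.presheaf.stalk P) := .of_isLocalization M
  have : Algebra.FormallySmooth k (X.presheaf.stalk P) := .comp k A _
  obtain ⟨ω, hω⟩ := exists_span_kaehlerDifferential_eq_top (k := k) (R := X.presheaf.stalk P) M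
  refine isDiscreteValuationRing_of_formallySmooth
    (exists_sub_algebraMap_mem_maximalIdeal k X P hP) ω hω fun h => ?_
  obtain ⟨b, hb⟩ := h.mul_inv_cancel ht.ne_zero
  exact ht.not_isUnit (IsUnit.of_mul_eq_one b hb)

end Stalk

/-! ### Functions without poles -/

section GlobalFunctions

variable {X : Scheme.{u}} [IsIntegral X]

/-- A rational function that is regular everywhere is a global section. -/
theorem exists_germToFunctionField_eq {f : X.functionField} (hf : ∀ ξ : X, IsRegularAt f ξ) :
    ∃ s : Γ(X, ⊤), X.presheaf.germ ⊤ (genericPoint X) trivial s = f := by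
  have hloc : ∀ ξ : X, ∃ (U : X.Opens) (_ : ξ ∈ U) (hg : genericPoint X ∈ U) (s : Γ(X, U)),
      X.presheaf.germ U (genericPoint X) hg s = f := by
    intro ξ
    obtain ⟨a, ha⟩ := hf ξ
    obtain ⟨U, hU, s, rfl⟩ := X.presheaf.exists_germ_eq a
    have : Nonempty U := ⟨⟨ξ, hU⟩⟩
    rw [Scheme.algebraMap_germ_eq_germToFunctionField] at ha
    exact ⟨U, hU, _, s, ha⟩
  choose U hU hg s hs using hloc
  obtain ⟨σ, hσ, -⟩ := X.sheaf.existsUnique_gluing' U ⊤ (fun ξ => homOfLE le_top)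
    (fun ξ _ => TopologicalSpace.Opens.mem_iSup.2 ⟨ξ, hU ξ⟩) s (by
      intro ξ η
      refine germ_injective_of_isIntegral X (genericPoint X)
        (show genericPoint X ∈ U ξ ⊓ U η from ⟨hg ξ, hg η⟩) ?_
      refine (X.presheaf.germ_res_apply _ _ _ _).trans (.trans ?_
        (X.presheaf.germ_res_apply _ _ _ _).symm)
      rw [hs, hs])
  refine ⟨σ, ?_⟩
  rw [← hs (genericPoint X), ← hσ (genericPoint X)]
  exact (X.presheaf.germ_res_apply _ _ _ _).symm

/-- On a proper integral scheme over an algebraically closed field, a rational function that is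
regular everywhere is constant. -/
theorem exists_eq_algebraMap_of_isRegularAt (k : Type u) [Field k] [IsAlgClosed k]
    [X.Over (Spec (.of k))] [IsProper (X ↘ Spec (.of k))] {f : X.functionField}
    (hf : ∀ ξ : X, IsRegularAt f ξ) : ∃ c : k, f = algebraMap k X.functionField c := by
  obtain ⟨s, rfl⟩ := exists_germToFunctionField_eq hf
  have hint : IsIntegral k (X.presheaf.germ ⊤ (genericPoint X) trivial s) := by
    have h1 : ((X ↘ Spec (.of k)).appTop.hom.comp
        (Scheme.ΓSpecIso (.of k)).inv.hom).IsIntegralElem s :=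
      RingHom.isIntegral_respectsIso.2 _ (Scheme.ΓSpecIso (.of k)).symm.commRingCatIsoToRingEquiv
        (isIntegral_appTop_of_universallyClosed (X ↘ Spec (.of k))) s
    exact h1.map (X.presheaf.germ ⊤ (genericPoint X) trivial).hom
  obtain ⟨c, hc⟩ := minpoly.mem_range_of_degree_eq_one k _
    (IsAlgClosed.degree_eq_one_of_irreducible k (minpoly.irreducible hint))
  exact ⟨c, hc.symm⟩

end GlobalFunctions

/-! ### Pole orders -/

section PoleOrders

open IsLocalRing

variable {X : Scheme.{u}} [IsIntegral X] {P : X}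

theorem algebraMap_stalk_injective (ξ : X) :
    Function.Injective (algebraMap (X.presheaf.stalk ξ) X.functionField) :=
  IsFractionRing.injective _ _

theorem HasPoleOfOrder.exists_unit [IsDiscreteValuationRing (X.presheaf.stalk P)] {n : ℕ}
    {f : X.functionField} (hf : HasPoleOfOrder P n f) {t : X.presheaf.stalk P}
    (ht : Irreducible t) :
    ∃ v : (X.presheaf.stalk P)ˣ, f * algebraMap (X.presheaf.stalk P) X.functionField t ^ n =
      algebraMap (X.presheaf.stalk P) X.functionField v := by
  obtain ⟨t', u, ht', h⟩ := hf
  obtain ⟨w, hw⟩ := IsDiscreteValuationRing.associated_of_irreducible _ ht' ht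
  refine ⟨u * w ^ n, ?_⟩
  rw [← hw, map_mul, mul_pow, ← mul_assoc, h]
  simp

theorem HasPoleOfOrder.ne_zero {n : ℕ} {f : X.functionField} (hf : HasPoleOfOrder P n f) :
    f ≠ 0 := by
  obtain ⟨t, u, -, h⟩ := hf
  rintro rfl
  rw [zero_mul] at h
  exact (map_ne_zero_iff _ (algebraMap_stalk_injective P)).2 u.ne_zero h.symm

theorem mul_mem_poleOrders {x : X.functionField} {d : ℕ} (hx : IsRegularAwayFrom P x)
    (hxd : HasPoleOfOrder P d x) (m : ℕ) : d * m ∈ poleOrders P := by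
  obtain ⟨t, u, ht, h⟩ := hxd
  refine ⟨x ^ m, fun ξ hξ => pow_mem (hx ξ hξ) m, t, u ^ m, ht, ?_⟩
  rw [pow_mul, ← mul_pow, h]
  simp

theorem infinite_poleOrders {x : X.functionField} {d : ℕ} (hd : 0 < d)
    (hx : IsRegularAwayFrom P x) (hxd : HasPoleOfOrder P d x) : (poleOrders P).Infinite :=
  Set.infinite_of_injective_forall_mem (fun _ _ h => Nat.eq_of_mul_eq_mul_left hd h)
    (mul_mem_poleOrders hx hxd)

/-- Among the first `n` terms of an increasing sequence of natural numbers that contains all the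
multiples of `d`, the multiples of `d` are `0, d, …, (N₀ - 1) d` for some `N₀`. -/
theorem exists_nth_eq_mul_iff_lt_card {p : ℕ → Prop} (hp : (Set.ofPred p).Infinite) {d : ℕ} (hd : 0 < d)
    (hpd : ∀ m, p (d * m)) (n m : ℕ) :
    (∃ i < n, Nat.nth p i = d * m) ↔
      m < ((Finset.range n).filter fun i => d ∣ Nat.nth p i).card := by
  have hmono := Nat.nth_strictMono hp
  have himage : ((Finset.range n).filter fun i => d ∣ Nat.nth p i).image
      (fun i => Nat.nth p i / d) = Finset.range ((Nat.nth p n + (d - 1)) / d) := by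
    ext m
    have hlt : m < (Nat.nth p n + (d - 1)) / d ↔ d * m < Nat.nth p n := by
      rw [← Nat.succ_le_iff, Nat.le_div_iff_mul_le hd, Nat.succ_mul, mul_comm m d]
      omega
    rw [Finset.mem_range, hlt, Finset.mem_image]
    constructor
    · rintro ⟨i, hi, rfl⟩
      rw [Finset.mem_filter, Finset.mem_range] at hi
      rw [Nat.mul_div_cancel' hi.2]
      exact hmono hi.1
    · intro h
      obtain ⟨i, hi⟩ : d * m ∈ Set.range (Nat.nth p) := by
        rw [Nat.range_nth_of_infinite hp]
        exact hpd m
      refine ⟨i, ?_, ?_⟩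
      · rw [Finset.mem_filter, Finset.mem_range, hi]
        exact ⟨hmono.lt_iff_lt.1 (hi ▸ h), dvd_mul_right d m⟩
      · rw [hi, Nat.mul_div_cancel_left m hd]
  have hcard : ((Finset.range n).filter fun i => d ∣ Nat.nth p i).card =
      (Nat.nth p n + (d - 1)) / d := by
    rw [← Finset.card_range ((Nat.nth p n + (d - 1)) / d), ← himage, Finset.card_image_of_injOn]
    intro i hi j hj hij
    rw [Finset.mem_coe, Finset.mem_filter] at hi hj
    exact hmono.injective ((Nat.div_left_inj hi.2 hj.2).1 hij)
  rw [hcard, ← Finset.mem_range, ← himage, Finset.mem_image]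
  constructor
  · rintro ⟨i, hi, h⟩
    exact ⟨i, Finset.mem_filter.2 ⟨Finset.mem_range.2 hi, h ▸ dvd_mul_right d m⟩,
      by rw [h, Nat.mul_div_cancel_left m hd]⟩
  · rintro ⟨i, hi, rfl⟩
    rw [Finset.mem_filter, Finset.mem_range] at hi
    exact ⟨i, hi.1, (Nat.mul_div_cancel' hi.2).symm⟩

variable (k : Type u) [Field k] [X.Over (Spec (.of k))]

attribute [local instance] stalkAlgebra isScalarTower_stalk_functionField

/-- A non-constant function is transcendental. -/
theorem transcendental_of_hasPoleOfOrder [IsAlgClosed k] {x : X.functionField} {d : ℕ} (hd : 0 < d)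
    (hxd : HasPoleOfOrder P d x) : Transcendental k x := by
  intro halg
  obtain ⟨c, rfl⟩ := minpoly.mem_range_of_degree_eq_one k x
    (IsAlgClosed.degree_eq_one_of_irreducible k (minpoly.irreducible halg.isIntegral))
  obtain ⟨t, u, ht, h⟩ := hxd
  rw [IsScalarTower.algebraMap_apply k (X.presheaf.stalk P), ← map_pow, ← map_mul] at h
  have h' := algebraMap_stalk_injective P h
  exact ht.not_isUnit (isUnit_of_dvd_unit
    ((dvd_pow_self t hd.ne').trans ⟨_, (mul_comm _ _).trans h' |>.symm⟩) u.isUnit)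

variable [IsAlgClosed k] [IsProper (X ↘ Spec (.of k))]

/-- The functions with a pole of order at most `m` at `P` and no other pole are spanned by any
choice of functions `g n` with a pole of order exactly `n`, for the pole orders `n ≤ m`. -/
theorem mem_span_of_isRegularAt_mul_pow [IsDiscreteValuationRing (X.presheaf.stalk P)]
    (hP : IsClosed {P}) {t : X.presheaf.stalk P} (ht : Irreducible t) {g : ℕ → X.functionField}
    (hg : ∀ n ∈ poleOrders P, IsRegularAwayFrom P (g n) ∧ HasPoleOfOrder P n (g n)) (m : ℕ)
    (f : X.functionField) (hf : IsRegularAwayFrom P f)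
    (hm : IsRegularAt (f * algebraMap (X.presheaf.stalk P) X.functionField t ^ m) P) :
    f ∈ Submodule.span k (g '' {n | n ∈ poleOrders P ∧ n ≤ m}) := by
  have hres := exists_sub_algebraMap_mem_maximalIdeal k X P hP
  have hinj := algebraMap_stalk_injective P
  have htower := IsScalarTower.algebraMap_apply k (X.presheaf.stalk P) X.functionField
  induction m using Nat.strong_induction_on generalizing f with
  | _ m ih =>
  have htm := (IsDiscreteValuationRing.irreducible_iff_uniformizer t).1 ht
  have hconst : ∀ c : k, algebraMap k (X.presheaf.stalk P) c ∈ maximalIdeal _ → c = 0 := by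
    intro c hc
    by_contra h
    exact (mem_maximalIdeal _).1 hc ((isUnit_iff_ne_zero.2 h).map (algebraMap k _))
  -- It suffices to treat the functions with a pole of order less than `m`: from the others one
  -- subtracts a multiple of `g m`.
  suffices hlow : ∀ (f : X.functionField) (a : X.presheaf.stalk P), IsRegularAwayFrom P f →
      a ∈ maximalIdeal (X.presheaf.stalk P) →
      f * algebraMap (X.presheaf.stalk P) X.functionField t ^ m = algebraMap _ _ a →
      f ∈ Submodule.span k (g '' {n | n ∈ poleOrders P ∧ n ≤ m}) by
    obtain ⟨a, ha⟩ := hm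
    obtain ⟨c, hc⟩ := hres a
    rcases eq_or_ne c 0 with rfl | hc0
    · rw [map_zero, sub_zero] at hc
      exact hlow f a hf hc ha.symm
    have hunit : IsUnit a := by
      by_contra h
      refine hc0 (hconst c ?_)
      simpa using Ideal.sub_mem _ ((mem_maximalIdeal a).2 h) hc
    have hmP : m ∈ poleOrders P := ⟨f, hf, t, hunit.unit, ht, ha.symm⟩
    obtain ⟨v, hv⟩ := (hg m hmP).2.exists_unit ht
    obtain ⟨c', hc'⟩ := hres v
    have hc'0 : c' ≠ 0 := by
      rintro rfl
      rw [map_zero, sub_zero] at hc'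
      exact (mem_maximalIdeal _).1 hc' v.isUnit
    have hgm : g m ∈ Submodule.span k (g '' {n | n ∈ poleOrders P ∧ n ≤ m}) :=
      Submodule.subset_span ⟨m, ⟨hmP, le_rfl⟩, rfl⟩
    rw [← sub_add_cancel f ((c / c') • g m)]
    refine Submodule.add_mem _ (hlow _ (a - algebraMap k _ (c / c') * v) ?_ ?_ ?_)
      (Submodule.smul_mem _ _ hgm)
    · intro ξ hξ
      rw [Algebra.smul_def]
      exact sub_mem (hf ξ hξ)
        (mul_mem (isRegularAt_algebraMap k _ ξ) ((hg m hmP).1 ξ hξ))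
    · have h1 : algebraMap k (X.presheaf.stalk P) (c / c') * algebraMap k _ c' =
          algebraMap k _ c := by
        rw [← map_mul, div_mul_cancel₀ _ hc'0]
      have h2 : a - algebraMap k _ (c / c') * v = (a - algebraMap k _ c) -
          algebraMap k _ (c / c') * (v - algebraMap k (X.presheaf.stalk P) c') := by
        linear_combination -h1
      rw [h2]
      exact Ideal.sub_mem _ hc (Ideal.mul_mem_left _ _ hc')
    · rw [sub_mul, ← ha, Algebra.smul_def, mul_assoc, hv, htower, map_sub, map_mul]
  intro f a hf ham ha
  rw [htm, Ideal.mem_span_singleton] at ham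
  obtain ⟨b, rfl⟩ := ham
  rcases m with _ | m
  · -- `f` has no pole, hence is constant, and it vanishes at `P`.
    rw [pow_zero, mul_one] at ha
    obtain ⟨c, hc⟩ := exists_eq_algebraMap_of_isRegularAt k (f := f) fun ξ => by
      rcases eq_or_ne ξ P with rfl | hξ
      · exact ⟨_, ha.symm⟩
      · exact hf ξ hξ
    have hcb : algebraMap k (X.presheaf.stalk P) c = t * b := hinj (by rw [← htower, ← hc, ha])
    have hc0 : c = 0 := hconst c (by
      rw [hcb, htm]
      exact Ideal.mul_mem_right _ _ (Ideal.mem_span_singleton_self t))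
    rw [hc, hc0, map_zero]
    exact zero_mem _
  · refine Submodule.span_mono (Set.image_mono ?_)
      (ih m (Nat.lt_succ_self m) f hf ⟨b, ?_⟩)
    · intro n hn
      exact ⟨hn.1, hn.2.trans m.le_succ⟩
    refine mul_right_cancel₀ ((map_ne_zero_iff _ hinj).2 ht.ne_zero) ?_
    rw [mul_assoc, ← pow_succ, ha, map_mul, mul_comm]

theorem dimRR_le_count [SmoothOfRelativeDimension 1 (X ↘ Spec (.of k))]
    (hP : IsClosed {P}) {t : X.presheaf.stalk P} (ht : Irreducible t)
    [DecidablePred (· ∈ poleOrders P)] (N : ℕ) :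
    dimRR k P N ≤ Nat.count (· ∈ poleOrders P) (N + 1) := by
  have := isDiscreteValuationRing_stalk k hP ht
  choose! g hg using fun n (hn : n ∈ poleOrders P) => hn
  classical
  let S : Finset ℕ := (Finset.range (N + 1)).filter (· ∈ poleOrders P)
  have hle : riemannRochSpace k P N ≤ Submodule.span k (S.image g : Set X.functionField) := by
    intro f hf
    have h := mem_span_of_isRegularAt_mul_pow k hP ht hg N f hf.1 (hf.2 t ht)
    refine Submodule.span_mono ?_ h
    rintro _ ⟨n, hn, rfl⟩
    refine Finset.mem_coe.2 (Finset.mem_image_of_mem g (Finset.mem_filter.2 ⟨?_, hn.1⟩))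
    exact Finset.mem_range.2 (Nat.lt_succ_of_le hn.2)
  calc dimRR k P N ≤ Module.finrank k (Submodule.span k (S.image g : Set X.functionField)) :=
        Submodule.finrank_mono hle
    _ ≤ (S.image g).card := finrank_span_finset_le_card _
    _ ≤ S.card := Finset.card_image_le
    _ = _ := (Nat.count_eq_card_filter_range _ _).symm

end PoleOrders

/-! ### The minors -/

section Minors

open IsLocalRing

variable {k : Type u} [Field k] [IsAlgClosed k] {X : Scheme.{u}} [IsIntegral X]
  [X.Over (Spec (.of k))] [SmoothOfRelativeDimension 1 (X ↘ Spec (.of k))]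

attribute [local instance] stalkAlgebra isScalarTower_stalk_functionField

/-- A minor of the wronskian matrix is non-zero if the determinant formed by the leading
coefficients of its entries is. -/
theorem minor_ne_zero [IsProper (X ↘ Spec (.of k))] {P : X} (hP : IsClosed {P}) {d : ℕ}
    (hd : (d : k) ≠ 0) {x : X.functionField} (hxd : HasPoleOfOrder P d x)
    [Algebra.IsSeparable (IntermediateField.adjoin k {x}) X.functionField]
    (y : ℕ → X.functionField) (hy : ∀ n, HasPoleOfOrder P (delta P n) (y n)) (N : ℕ)
    (s : Fin (dimRR k P N) → ℕ)
    (hs : (Matrix.of fun i j : Fin (dimRR k P N) =>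
      (descPochhammer k (s j)).eval (delta P i / d : k)).det ≠ 0) :
    minor k P x y N s ≠ 0 := by
  have hd0 : 0 < d := Nat.pos_of_ne_zero fun h => hd (by rw [h, Nat.cast_zero])
  have hx := transcendental_of_hasPoleOfOrder k hd0 hxd
  obtain ⟨t, u, ht, hu⟩ := hxd
  have := isDiscreteValuationRing_stalk k hP ht
  have := essFiniteType_stalk k X P
  obtain ⟨D, hD, -⟩ := existsUnique_isStandard (k := k) x hx
  choose v hv using fun n => (hy n).exists_unit ht
  choose r hr hrow using fun i n => exists_pow_mul_iterate_eq_mul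
    (exists_sub_algebraMap_mem_maximalIdeal k X P hP) t
    ((IsDiscreteValuationRing.irreducible_iff_uniformizer t).1 ht) D.derivation
    hD.derivation_self hd u hu (v i) (hv i) n
  refine det_ne_zero_of_residue (algebraMap_stalk_injective P) _ (fun i => y i)
    (fun j => x ^ s j * (s j).factorial) _ (Matrix.of fun i j => r i (s j))
    (fun i j => hr i (s j)) (fun i => (hy i).ne_zero) (fun i j => ?_) hs
  rw [Matrix.submatrix_apply, wronskianMatrix, Matrix.of_apply, id_eq, hasseD_eq x hx D hD,
    mul_assoc, ← hD.derivation_iterate, hrow]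
  rfl

end Minors

end CurveWronskian

theorem mainTheorem4 (k : Type u) [Field k] [IsAlgClosed k] (p : ℕ) [CharP k p]
    (X : Scheme.{u}) [IsIntegral X] [X.Over (Spec (.of k))]
    [IsProper (X ↘ Spec (.of k))] [SmoothOfRelativeDimension 1 (X ↘ Spec (.of k))]
    (P : X) (hP : IsClosed {P})
    (d : ℕ) (hd : 0 < d) (x : X.functionField)
    (hx : CurveWronskian.IsRegularAwayFrom P x) (hxd : CurveWronskian.HasPoleOfOrder P d x)
    [Algebra.IsSeparable (IntermediateField.adjoin k {x}) X.functionField]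
    (y : ℕ → X.functionField)
    (hy : ∀ n, CurveWronskian.IsRegularAwayFrom P (y n) ∧
      CurveWronskian.HasPoleOfOrder P (CurveWronskian.delta P n) (y n))
    (N : ℕ) (hN : 2 ≤ N) :
    (p = 0 → ∀ r : ℕ, r + CurveWronskian.dimRR k P N ≤ N →
      CurveWronskian.minor k P x y N (CurveWronskian.columnSeq k P d N r) ≠ 0) ∧
    ((p = 0 ∨ (N < p ∧ ¬ p ∣ d)) → CurveWronskian.Delta k P x y N ≠ 0) := by
  have hinf := CurveWronskian.infinite_poleOrders hd hx hxd
  have hδ : Function.Injective (CurveWronskian.delta P) := (Nat.nth_strictMono hinf).injective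
  constructor
  · rintro rfl r -
    have := CharP.charP_to_charZero k
    have hdk : (d : k) ≠ 0 := Nat.cast_ne_zero.2 hd.ne'
    have hmul : ∀ i m : ℕ, (CurveWronskian.delta P i / d : k) = m ↔
        CurveWronskian.delta P i = d * m := by
      intro i m
      rw [div_eq_iff hdk, mul_comm, ← Nat.cast_mul, Nat.cast_inj]
    have hcard := CurveWronskian.exists_nth_eq_mul_iff_lt_card hinf hd
      (CurveWronskian.mul_mem_poleOrders hx hxd) (CurveWronskian.dimRR k P N)
    refine CurveWronskian.minor_ne_zero hP hdk hxd y (fun n => (hy n).2) N _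
      (CurveWronskian.det_descPochhammer_ne_zero _ ?_ (CurveWronskian.numDivisible k P d N)
        (N - CurveWronskian.dimRR k P N - r) ?_ ?_ _ fun i => rfl)
    · intro i j hij
      exact Fin.ext (hδ (Nat.cast_injective ((div_left_inj' hdk).1 hij)))
    · intro m hm
      obtain ⟨i, hi, h⟩ := (hcard m).2 hm
      exact ⟨⟨i, hi⟩, (hmul i m).2 h⟩
    · intro i m h
      exact (hcard m).1 ⟨i, i.2, (hmul i m).1 h⟩
  · intro hp
    have hdk : (d : k) ≠ 0 := by
      rw [Ne, CharP.cast_eq_zero_iff k p]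
      rcases hp with rfl | hp
      · rw [zero_dvd_iff]
        exact hd.ne'
      · exact hp.2
    refine CurveWronskian.minor_ne_zero hP hdk hxd y (fun n => (hy n).2) N _ ?_
    rw [CurveWronskian.det_descPochhammer_eq_det_vandermonde, Matrix.det_vandermonde_ne_zero_iff]
    intro i j hij
    have hij' : (CurveWronskian.delta P i : k) = CurveWronskian.delta P j :=
      (div_left_inj' hdk).1 hij
    refine Fin.ext (hδ ?_)
    rcases hp with rfl | ⟨hNp, -⟩
    · have := CharP.charP_to_charZero k
      exact Nat.cast_injective hij'
    · obtain ⟨t, -, ht, -⟩ := id hxd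
      classical
      have hlt : ∀ i : Fin (CurveWronskian.dimRR k P N), CurveWronskian.delta P i < p := by
        intro i
        have h := Nat.nth_lt_of_lt_count
          (lt_of_lt_of_le i.2 (CurveWronskian.dimRR_le_count k hP ht N))
        exact lt_of_lt_of_le h hNp
      exact CharP.natCast_injOn_Iio k p (hlt i) (hlt j) hij'
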